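/- **Model.** A dynamic graph on a set $V$ of $n$ anonymous nodes consists of a footprint $G=(V,E)$ (a simple undirected graph) and snapshots $\mathcal G_r=(V,E_r)$, $E_r\subseteq E$, $r=0,1,2,\dots$; at every node $v$ the footprint edges at $v$ are labelled bijectively by fixed ports $0,\dots,\deg_G(v)-1$. It is $\ell$-bounded 1-interval connected if every $\mathcal G_r$ is connected and $|E\setminus E_r|\le \ell$ for all $r$. There are $k\ge 1$ agents with distinct identifiers in $[1,n^c]$, where $c$ is a constant; each agent initially knows only its own identifier, and $n,k,\ell,c$ are unknown to the agents. Rounds are synchronous. At the beginning of round $r$ every agent sees (1-hop visibility) the identifiers of the agents at its node and, for each port of its node, whether its edge is in $E_r$ and, if so, the identifiers of the agents at the neighbour; it also knows whether its move in the previous round succeeded. It broadcasts a message, which all agents receive (global communication), then deterministically computes its new memory and decides to stay, to move through a port (the move fails if the edge is missing), or to terminate for ever. Memory is the number of bits an agent keeps between rounds. A configuration is a *$k$-balanced dispersion* if every node has at least $\lfloor k/n\rfloor$ and at most $\lceil k/n\rceil$ agents. **Algorithm.** Each occupied node is named by the smallest identifier of an agent at it. In every round this agent broadcasts its node's name and number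 of agents and, for each port, whether the edge is missing, leads to a hole (a node without agents), or leads to an occupied node, with that node's name. Thus all agents obtain the same map $G'$ of the subgraph of $\mathcal G_r$ induced by the occupied nodes. Only the agent of smallest identifier at each node may move. An agent stores its identifier and a bit $P$, initially $0$. * $P=0$. If some occupied node has a hole as a neighbour and some node has at least two agents, then in each component of $G'$ that contains a node with at least two agents and a node adjacent to a hole, take a shortest path from a node of the first kind to a node of the second kind (ties broken by the names of its start, then of its end, then lexicographically); each smallest-identifier agent on this path moves to the next node of the path, the last one to a hole through its first port leading to a hole. If some occupied node has a hole as a neighbour but no node has two agents, all agents terminate. If no occupied node has a hole as a neighbour, all agents set $P=1$. * $P=1$. If all numbers of agents at the nodes of $G'$ lie between the floor and the ceiling of their average, all agents terminate. Otherwise take the lexicographically first shortest path in $G'$ from the node of smallest name among those with the maximal number of agents to the node of smallest name among those with the minimal number of agents; each smallest-identifier agent on this path, except at its end, moves to the next node. **Theorem.** There is an absolute constant $C$, and for every $c$ a constant $C_c$, such that for all $n$, $k\ge1$ and $\ell$, every $\ell$-bounded 1-interval connected dynamic graph on $n$ nodes, every assignment of distinct identifiers in $[1,n^c]$ to $k$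 agents, and every initial placement of the $k$ agents, the algorithm has the following properties. There is $T\le Ck$ such that after $T$ rounds all agents have terminated and the configuration is, and remains, a $k$-balanced dispersion. Whenever some agent has terminated, the configuration is a $k$-balanced dispersion. In every round every agent's memory has at most $C_c(\lfloor\log_2 n\rfloor+1)$ bits. -/

import Mathlib

namespace BalancedDispersion

/-! ## Time-varying graphs with a fixed port-labelled footprint -/

/-- A time-varying graph on the node set `V`: a footprint, its snapshot in every round (a spanning
subgraph of the footprint), and at each node `v` a bijective labelling of the footprint edges at `v`
by the ports `0, …, deg v - 1`. Ports do not change over time. -/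
structure DynamicGraph (V : Type*) where
  footprint : SimpleGraph V
  snapshot : ℕ → SimpleGraph V
  snapshot_le : ∀ r, snapshot r ≤ footprint
  port : ∀ v, Fin (footprint.neighborSet v).ncard ≃ footprint.neighborSet v

/-- Every snapshot is connected and misses at most `ℓ` edges of the footprint. -/
def DynamicGraph.IsBoundedOneIntervalConnected {V : Type*} (D : DynamicGraph V) (ℓ : ℕ) : Prop :=
  ∀ r, (D.snapshot r).Connected ∧
    (D.footprint.edgeSet \ (D.snapshot r).edgeSet).encard ≤ ℓ

open Classical in
/-- The node reached in round `r` from `v` through port `q`; `none` if there is no such port or its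
edge is missing in round `r`. -/
noncomputable def DynamicGraph.target {V : Type*} (D : DynamicGraph V) (r : ℕ) (v : V) (q : ℕ) :
    Option V :=
  if h : q < (D.footprint.neighborSet v).ncard then
    if (D.snapshot r).Adj v (D.port v ⟨q, h⟩) then some (D.port v ⟨q, h⟩ : V) else none
  else none

/-! ## Agents with 1-hop visibility and global communication -/

/-- What an agent sees at the beginning of a round with 1-hop visibility. Nodes have no names. -/
structure LocalView where
  /-- the identifiers of the agents at its own node -/
  here : Finset ℕ
  /-- one entry per footprint port of its node: `none` if the edge is missing in this round, and
  otherwise the set of identifiers of the agents at the neighbour (empty for a hole) -/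
  ports : List (Option (Finset ℕ))
  /-- `some true` / `some false` if it tried to move in the last round and succeeded / failed -/
  lastMove : Option Bool

/-- The decision of an agent: stay, move through a port, or terminate. -/
inductive Action where
  | stay : Action
  | move (q : ℕ) : Action
  | halt : Action

/-- A deterministic algorithm, the same for all agents, not depending on the graph, on the number
of nodes or agents, or on the range of the identifiers. The memory that an agent keeps from one
round to the next is a bit string. In each round an agent broadcasts at most one message,
depending on its memory and its view; then it computes its new memory and its action from its
memory, its view, and the messages broadcast in this round. -/
structure Algorithm where
  Msg : Type
  init : ℕ → List Bool
  send : List Bool → LocalView → Option Msg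
  act : List Bool → LocalView → Multiset Msg → List Bool × Action

/-- The state of the system at the beginning of a round. -/
structure Config (V A : Type*) where
  pos : A → V
  mem : A → List Bool
  halted : A → Bool
  lastMove : A → Option Bool

section Execution

variable {V A : Type*} [DecidableEq V] [Fintype A]

/-- The identifiers of the agents located at `v`. -/
def idsAt (ids : A → ℕ) (pos : A → V) (v : V) : Finset ℕ :=
  (Finset.univ.filter fun a => pos a = v).image ids

/-- The 1-hop view of agent `a` at the beginning of round `r`. -/
noncomputable def localView (D : DynamicGraph V) (ids : A → ℕ) (r : ℕ) (C : Config V A) (a : A) :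
    LocalView where
  here := idsAt ids C.pos (C.pos a)
  ports := List.ofFn fun q : Fin (D.footprint.neighborSet (C.pos a)).ncard =>
    (D.target r (C.pos a) q).map (idsAt ids C.pos)
  lastMove := C.lastMove a

/-- The messages received by everybody in round `r`; terminated agents are silent. -/
noncomputable def messages (alg : Algorithm) (D : DynamicGraph V) (ids : A → ℕ) (r : ℕ)
    (C : Config V A) : Multiset alg.Msg :=
  (Finset.univ : Finset A).val.filterMap fun a =>
    if C.halted a then none else alg.send (C.mem a) (localView D ids r C a)

/-- The new memory and the action of agent `a` in round `r`; a terminated agent does nothing. -/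
noncomputable def decision (alg : Algorithm) (D : DynamicGraph V) (ids : A → ℕ) (r : ℕ)
    (C : Config V A) (a : A) : List Bool × Action :=
  if C.halted a then (C.mem a, Action.halt)
  else alg.act (C.mem a) (localView D ids r C a) (messages alg D ids r C)

/-- One synchronous Communicate-Compute-Move round. A move through a missing edge fails. -/
noncomputable def step (alg : Algorithm) (D : DynamicGraph V) (ids : A → ℕ) (r : ℕ)
    (C : Config V A) : Config V A where
  pos a := match (decision alg D ids r C a).2 with
    | Action.move q => (D.target r (C.pos a) q).getD (C.pos a)
    | _ => C.pos a
  mem a := (decision alg D ids r C a).1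
  halted a := match (decision alg D ids r C a).2 with
    | Action.halt => true
    | _ => false
  lastMove a := match (decision alg D ids r C a).2 with
    | Action.move q => some (D.target r (C.pos a) q).isSome
    | _ => none

/-- The configuration at the beginning of round `r`, that is, after `r` complete rounds. -/
noncomputable def run (alg : Algorithm) (D : DynamicGraph V) (ids : A → ℕ) (start : A → V) :
    ℕ → Config V A
  | 0 => ⟨start, fun a => alg.init (ids a), fun _ => false, fun _ => none⟩
  | r + 1 => step alg D ids r (run alg D ids start r)

/-- Balanced dispersion of the `k = |A|` agents over the `n = |V|` nodes: every node has at least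
`⌊k/n⌋` and at most `⌈k/n⌉` agents. -/
def IsBalanced [Fintype V] (pos : A → V) : Prop :=
  ∀ v, ⌊(Fintype.card A : ℚ) / Fintype.card V⌋₊ ≤ (Finset.univ.filter fun a => pos a = v).card ∧
    (Finset.univ.filter fun a => pos a = v).card ≤ ⌈(Fintype.card A : ℚ) / Fintype.card V⌉₊

end Execution

/-! ## The algorithm -/

/-- The smallest identifier in a set; `none` for a hole. -/
def leader (S : Finset ℕ) : Option ℕ :=
  if h : S.Nonempty then some (S.min' h) else none

/-- The information broadcast about an occupied node: its number of agents, the smallest identifier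
there, and for every port `none` if its edge is missing, `some none` if it leads to a hole, and
`some (some i)` if it leads to an occupied node with smallest identifier `i`. -/
structure Report where
  load : ℕ
  id : ℕ
  ports : List (Option (Option ℕ))

def report (w : LocalView) : Report :=
  ⟨w.here.card, (leader w.here).getD 0, w.ports.map (Option.map leader)⟩

/-- The memory holds the phase bit `P` and the binary expansion of the identifier. -/
def memory (P : Bool) (id : ℕ) : List Bool := P :: id.bits

def phaseOf (m : List Bool) : Bool := m.headD false

def idOf (m : List Bool) : ℕ := m.tail.foldr Nat.bit 0

/-- The partial map of the current snapshot that the reports give; an occupied node is named by the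
smallest identifier at it. -/
def mapGraph (M : Multiset Report) : SimpleGraph ℕ :=
  SimpleGraph.fromRel fun u v => ∃ s ∈ M, s.id = u ∧ some (some v) ∈ s.ports

/-- The first `d + 1` nodes of the walk from `u` that always goes to the neighbour of smallest name
among those closer to `w`. For `d = dist u w` this is the lexicographically first among the shortest
paths from `u` to `w`. -/
noncomputable def pathAux (G : SimpleGraph ℕ) (w : ℕ) : ℕ → ℕ → List ℕ
  | 0, u => [u]
  | d + 1, u => u :: pathAux G w d (sInf {z | G.Adj u z ∧ G.dist z w + 1 = G.dist u w})

/-- The lexicographically first shortest path from `u` to `w`. -/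
noncomputable def shortestPath (G : SimpleGraph ℕ) (u w : ℕ) : List ℕ :=
  pathAux G w (G.dist u w) u

/-- The node after `z` on a path; `none` if `z` is its end or is not on it. -/
def nextOn (p : List ℕ) (z : ℕ) : Option ℕ := p[p.idxOf z + 1]?

/-- Some reported node has a hole as a neighbour. -/
def HoleSeen (M : Multiset Report) : Prop := ∃ s ∈ M, some none ∈ s.ports

/-- Some reported node is a multinode. -/
def MultinodeSeen (M : Multiset Report) : Prop := ∃ s ∈ M, 1 < s.load

/-- In the component of `z` in the partial map, `u` is a multinode, `v` is a node with a hole as a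
neighbour, and their distance is `d`. -/
def IsSlide (M : Multiset Report) (z d u v : ℕ) : Prop :=
  (mapGraph M).Reachable z u ∧ (mapGraph M).Reachable u v ∧ (mapGraph M).dist u v = d ∧
    (∃ s ∈ M, s.id = u ∧ 1 < s.load) ∧ (∃ s ∈ M, s.id = v ∧ some none ∈ s.ports)

open Classical in
/-- The path of the slide in the component of `z`: a shortest one from a multinode to a node with a
hole as a neighbour (so all its nodes but the first have exactly one agent), ties being broken by
the names of its start and its end and then lexicographically. Empty if there is none. -/
noncomputable def slidePath (M : Multiset Report) (z : ℕ) : List ℕ :=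
  if ∃ d u v, IsSlide M z d u v then
    let d := sInf {d | ∃ u v, IsSlide M z d u v}
    let u := sInf {u | ∃ v, IsSlide M z d u v}
    let v := sInf {v | IsSlide M z d u v}
    shortestPath (mapGraph M) u v
  else []

/-- Go to the neighbour named `u`. -/
def goTo (w : LocalView) (u : ℕ) : Action :=
  Action.move ((report w).ports.idxOf (some (some u)))

open Classical in
/-- The action of the agent with the smallest identifier `id` at its node when holes are filled:
along the slide path to the next node, and from its last node through the first port to a hole. -/
noncomputable def slideAction (id : ℕ) (w : LocalView) (M : Multiset Report) : Action :=
  if id ∈ slidePath M id then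
    match nextOn (slidePath M id) id with
    | some u => goTo w u
    | none => Action.move ((report w).ports.idxOf (some none))
  else Action.stay

/-- The largest and the smallest number of agents at a reported node. -/
def maxLoad (M : Multiset Report) : ℕ := (M.map Report.load).sup

noncomputable def minLoad (M : Multiset Report) : ℕ := sInf {m | ∃ s ∈ M, s.load = m}

/-- The smallest name of a reported node with load `m`. -/
noncomputable def firstWithLoad (M : Multiset Report) (m : ℕ) : ℕ :=
  sInf {i | ∃ s ∈ M, s.id = i ∧ s.load = m}

/-- The reported loads lie between the floor and the ceiling of their average. -/
def LoadsBalanced (M : Multiset Report) : Prop :=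
  ⌊((M.map Report.load).sum : ℚ) / M.card⌋₊ ≤ minLoad M ∧
    maxLoad M ≤ ⌈((M.map Report.load).sum : ℚ) / M.card⌉₊

/-- The action of the agent with the smallest identifier `id` at its node when loads are balanced:
along the path from the first node of maximal load to the first node of minimal load. -/
noncomputable def balanceAction (id : ℕ) (w : LocalView) (M : Multiset Report) : Action :=
  match nextOn (shortestPath (mapGraph M) (firstWithLoad M (maxLoad M))
      (firstWithLoad M (minLoad M))) id with
  | some u => goTo w u
  | none => Action.stay

open Classical in
/-- The algorithm. In each round the agent of smallest identifier at each node broadcasts the report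
of its node, and only these agents may move. In phase `P = 0`, as long as there are a hole and a
multinode, agents slide into holes; if there are holes but no multinode, all agents terminate; if
there is no hole, they switch to phase `P = 1`. In phase `P = 1` agents slide along a shortest path
from a node of maximal load to a node of minimal load, until the loads are balanced; then all
agents terminate. -/
noncomputable def fillThenBalance : Algorithm where
  Msg := Report
  init id := memory false id
  send m w := if leader w.here = some (idOf m) then some (report w) else none
  act m w M :=
    if phaseOf m = false then
      if HoleSeen M then
        if MultinodeSeen M then
          (m, if leader w.here = some (idOf m) then slideAction (idOf m) w M else Action.stay)
        else (m, Action.halt)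
      else (memory true (idOf m), Action.stay)
    else
      if LoadsBalanced M then (m, Action.halt)
      else (m, if leader w.here = some (idOf m) then balanceAction (idOf m) w M else Action.stay)

end BalancedDispersion

namespace BalancedDispersion

/-! ## Shortest paths -/

/-! Two potentials drive the proof, and each moves strictly in every nonterminal round of its phase.
While holes and multinodes coexist, the number of occupied nodes grows. A walk in the connected
snapshot from a multinode to a hole meets a first hole, so the multinode's component of the map
contains a node adjacent to a hole (`exists_adj_hole`) and a slide exists there. A slide empties no
node: its start keeps a second agent and every later node receives its predecessor's leader
(`IsActive.exists_slide_step_pos_eq`), while the last leader enters a hole. Hence there are at most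
`k` such rounds (`IsActive.card_image_lt`). If holes remain without multinodes, then `k < n` and the
configuration is already balanced. Once no hole is left, the map is connected and the reports reveal
`k` and `n`. A round carries one unit of load from a maximal to a minimal node, because the shifts
along the path telescope (`load_eq_of_shift`). This lowers the total distance of the loads from the
interval between `⌊k/n⌋` and `⌈k/n⌉` (`imbalance_lt_of_transfer`), which is at most `2k`. All
decisions rest on the common multiset of reports, so phase changes and termination are simultaneous.
`IsProper` combines both potentials into one countdown from `3k + 2`. -/

theorem exists_pathAux_eq_map (G : SimpleGraph ℕ) (w : ℕ) :
    ∀ (d u : ℕ), G.Reachable u w → G.dist u w = d →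
      ∃ f : ℕ → ℕ, pathAux G w d u = (List.range (d + 1)).map f ∧ f 0 = u ∧ f d = w ∧
        (∀ i < d, G.Adj (f i) (f (i + 1))) ∧ ∀ i ≤ d, G.dist (f i) w = d - i := by
  intro d
  induction d with
  | zero =>
    intro u hu hd
    have : u = w := hu.dist_eq_zero_iff.1 hd
    subst this
    exact ⟨fun _ => u, by simp [pathAux], rfl, rfl, by simp, by simp⟩
  | succ d ih =>
    intro u hu hd
    -- The second vertex of a geodesic is a candidate, so the `sInf` in `pathAux` is a genuine
    -- minimum and not the default `0`.
    have hne : {z | G.Adj u z ∧ G.dist z w + 1 = G.dist u w}.Nonempty := by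
      obtain ⟨p, hp⟩ := hu.exists_walk_length_eq_dist
      cases p with
      | nil => simp at hd
      | @cons _ v _ h q =>
        refine ⟨v, h, ?_⟩
        have h1 : G.dist v w ≤ q.length := SimpleGraph.dist_le q
        have h2 : G.dist u w ≤ G.dist v w + 1 := by
          obtain ⟨q', hq'⟩ := q.reachable.exists_walk_length_eq_dist
          simpa [hq'] using SimpleGraph.dist_le (SimpleGraph.Walk.cons h q')
        simp only [SimpleGraph.Walk.length_cons] at hp
        omega
    obtain ⟨hadj, hdist⟩ := Nat.sInf_mem hne
    set z := sInf {z | G.Adj u z ∧ G.dist z w + 1 = G.dist u w} with hz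
    obtain ⟨f, hf, h0, hd', hA, hD⟩ := ih z (hadj.reachable.symm.trans hu) (by omega)
    refine ⟨fun i => Nat.casesOn i u f, ?_, rfl, hd', ?_, ?_⟩
    · rw [pathAux, ← hz, hf, List.range_succ_eq_map (n := d + 1)]
      simp [Function.comp_def]
    · rintro (_ | i) hi
      · simpa [h0] using hadj
      · exact hA i (by omega)
    · rintro (_ | i) hi
      · simpa using hd
      · simpa using hD i (by omega)

/-- A shortest path, parametrized by an injective sequence of `d + 1` nodes. -/
structure IsPathSeq (G : SimpleGraph ℕ) (p : List ℕ) (d : ℕ) (f : ℕ → ℕ) : Prop where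
  eq_map : p = (List.range (d + 1)).map f
  adj : ∀ i < d, G.Adj (f i) (f (i + 1))
  inj : ∀ i ≤ d, ∀ j ≤ d, f i = f j → i = j

theorem exists_isPathSeq_shortestPath {G : SimpleGraph ℕ} {u w : ℕ} (h : G.Reachable u w) :
    ∃ d f, IsPathSeq G (shortestPath G u w) d f ∧ f 0 = u ∧ f d = w := by
  obtain ⟨f, hf, h0, hd, hA, hD⟩ := exists_pathAux_eq_map G w _ u h rfl
  refine ⟨_, f, ⟨hf, hA, fun i hi j hj hij => ?_⟩, h0, hd⟩
  -- The distance to `w` determines the index; `i, j ≤ d` keeps the subtraction `d - i` from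
  -- truncating.
  have h1 := hD i hi
  have h2 := hD j hj
  rw [hij] at h1
  omega

namespace IsPathSeq

variable {G : SimpleGraph ℕ} {p : List ℕ} {d : ℕ} {f : ℕ → ℕ}

theorem mem_iff (h : IsPathSeq G p d f) {z : ℕ} : z ∈ p ↔ ∃ i ≤ d, f i = z := by
  simp [h.eq_map]

theorem idxOf_apply (h : IsPathSeq G p d f) {i : ℕ} (hi : i ≤ d) : p.idxOf (f i) = i := by
  have hnd : p.Nodup := by
    rw [h.eq_map]
    refine List.Nodup.map_on (fun x hx y hy => ?_) List.nodup_range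
    simp only [List.mem_range] at hx hy
    exact h.inj x (by omega) y (by omega)
  have hl : i < p.length := by simp [h.eq_map]; omega
  have : p[i] = f i := by simp [h.eq_map]
  rw [← this, hnd.idxOf_getElem]

theorem nextOn_apply (h : IsPathSeq G p d f) {i : ℕ} (hi : i < d) :
    nextOn p (f i) = some (f (i + 1)) := by
  rw [nextOn, h.idxOf_apply hi.le, h.eq_map]
  simp [hi]

theorem nextOn_last (h : IsPathSeq G p d f) : nextOn p (f d) = none := by
  rw [nextOn, h.idxOf_apply le_rfl, h.eq_map]
  simp

/-- For an absent element `idxOf` returns the length, so the lookup is out of range. -/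
theorem nextOn_of_notMem {z : ℕ} (hz : z ∉ p) : nextOn p z = none := by
  rw [nextOn, List.idxOf_eq_length hz]
  simp

theorem reachable (h : IsPathSeq G p d f) {i : ℕ} (hi : i ≤ d) : G.Reachable (f 0) (f i) := by
  induction i with
  | zero => rfl
  | succ i ih => exact (ih (by omega)).trans (h.adj i (by omega)).reachable

end IsPathSeq

/-- `IsSlide` depends on `z` only through its component, so all leaders of one component agree on
the slide without further communication. -/
theorem slidePath_congr {M : Multiset Report} {z z' : ℕ} (h : (mapGraph M).Reachable z z') :
    slidePath M z = slidePath M z' := by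
  have : IsSlide M z = IsSlide M z' := by
    funext d u v
    simp only [IsSlide, eq_iff_iff]
    exact and_congr_left fun _ => ⟨h.symm.trans, h.trans⟩
  unfold slidePath
  rw [this]

theorem slidePath_eq_nil {M : Multiset Report} {z : ℕ} (h : ¬ ∃ d u v, IsSlide M z d u v) :
    slidePath M z = [] := if_neg h

theorem exists_slidePath_eq {M : Multiset Report} {z : ℕ} (h : ∃ d u v, IsSlide M z d u v) :
    ∃ d u v, IsSlide M z d u v ∧ slidePath M z = shortestPath (mapGraph M) u v := by
  rw [slidePath, if_pos h]
  -- Attaining each infimum is exactly the nonemptiness needed for the next one.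
  have h1 : {d | ∃ u v, IsSlide M z d u v}.Nonempty := h
  have h2 := Nat.sInf_mem h1
  have h3 := Nat.sInf_mem (s := {u | ∃ v, IsSlide M z (sInf {d | ∃ u v, IsSlide M z d u v}) u v}) h2
  exact ⟨_, _, _, Nat.sInf_mem h3, rfl⟩

/-! ## Names, reports and the map of the occupied nodes -/

section Names

variable {V A : Type*} [DecidableEq V] [Fintype A] {ids : A → ℕ} {pos : A → V}

theorem mem_idsAt {v : V} {i : ℕ} : i ∈ idsAt ids pos v ↔ ∃ a, pos a = v ∧ ids a = i := by
  simp [idsAt]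

theorem leader_eq_some_iff {S : Finset ℕ} {i : ℕ} :
    leader S = some i ↔ i ∈ S ∧ ∀ j ∈ S, i ≤ j := by
  unfold leader
  split_ifs with h
  · rw [Option.some_inj]
    constructor
    · rintro rfl
      exact ⟨S.min'_mem h, fun j hj => S.min'_le j hj⟩
    · rintro ⟨h1, h2⟩
      exact le_antisymm (S.min'_le i h1) (h2 _ (S.min'_mem h))
  · rw [Finset.not_nonempty_iff_eq_empty] at h
    simp [h]

theorem leader_idsAt_eq_none {v : V} :
    leader (idsAt ids pos v) = none ↔ ∀ a, pos a ≠ v := by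
  unfold leader
  split_ifs with h
  · obtain ⟨i, hi⟩ := h
    obtain ⟨a, ha, -⟩ := mem_idsAt.1 hi
    simpa using ⟨a, ha⟩
  · simp only [true_iff]
    intro a ha
    exact h ⟨ids a, mem_idsAt.2 ⟨a, ha, rfl⟩⟩

/-- The agent `a` has the smallest identifier at its node. -/
def IsLeader (ids : A → ℕ) (pos : A → V) (a : A) : Prop :=
  leader (idsAt ids pos (pos a)) = some (ids a)

instance : DecidablePred (IsLeader ids pos) := fun a =>
  inferInstanceAs (Decidable (leader (idsAt ids pos (pos a)) = some (ids a)))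

theorem exists_isLeader (ids : A → ℕ) {v : V} (h : ∃ a, pos a = v) :
    ∃ a, pos a = v ∧ IsLeader ids pos a := by
  cases hl : leader (idsAt ids pos v) with
  | none => exact absurd h (by simpa using leader_idsAt_eq_none.1 hl)
  | some i =>
    obtain ⟨a, ha, rfl⟩ := mem_idsAt.1 (leader_eq_some_iff.1 hl).1
    exact ⟨a, ha, by rw [IsLeader, ha, hl]⟩

theorem exists_isLeader_of_leader_eq {v : V} {i : ℕ} (h : leader (idsAt ids pos v) = some i) :
    ∃ a, pos a = v ∧ IsLeader ids pos a ∧ ids a = i := by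
  obtain ⟨a, ha, rfl⟩ := mem_idsAt.1 (leader_eq_some_iff.1 h).1
  exact ⟨a, ha, by rw [IsLeader, ha, h], rfl⟩

theorem eq_pos_of_leader_eq (hids : Function.Injective ids) {a : A} {v : V}
    (h : leader (idsAt ids pos v) = some (ids a)) : pos a = v := by
  obtain ⟨b, hb, -, hba⟩ := exists_isLeader_of_leader_eq h
  rw [← hids hba, hb]

theorem IsLeader.eq_of_pos_eq (hids : Function.Injective ids) {a b : A}
    (ha : IsLeader ids pos a) (hb : IsLeader ids pos b) (h : pos a = pos b) : a = b := by
  rw [IsLeader, h, hb] at ha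
  exact (hids (Option.some_inj.1 ha)).symm

/-- The number of agents at `v`. -/
def load (pos : A → V) (v : V) : ℕ := (Finset.univ.filter fun a => pos a = v).card

theorem card_idsAt (hids : Function.Injective ids) (v : V) :
    (idsAt ids pos v).card = load pos v :=
  Finset.card_image_of_injective _ hids

theorem load_pos_iff {v : V} : 0 < load pos v ↔ ∃ a, pos a = v := by
  simp [load, Finset.card_pos, Finset.Nonempty]

theorem sum_load [Fintype V] (pos : A → V) : ∑ v, load pos v = Fintype.card A :=
  (Finset.card_eq_sum_card_fiberwise fun a _ => Finset.mem_univ (pos a)).symm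

variable (D : DynamicGraph V) (r : ℕ)

omit [DecidableEq V] in
theorem target_eq_some {v y : V} {q : ℕ} (h : D.target r v q = some y) :
    (D.snapshot r).Adj v y := by
  unfold DynamicGraph.target at h
  split_ifs at h with h1 h2
  rw [← Option.some_inj.1 h]
  exact h2

omit [DecidableEq V] in
theorem exists_target_eq {v y : V} (h : (D.snapshot r).Adj v y) :
    ∃ q : Fin (D.footprint.neighborSet v).ncard, D.target r v q = some y := by
  refine ⟨(D.port v).symm ⟨y, D.snapshot_le r h⟩, ?_⟩
  simp [DynamicGraph.target, h]

/-- The report of the node `v`. -/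
noncomputable def nodeReport (ids : A → ℕ) (pos : A → V) (v : V) : Report :=
  ⟨(idsAt ids pos v).card, (leader (idsAt ids pos v)).getD 0,
    List.ofFn fun q : Fin (D.footprint.neighborSet v).ncard =>
      (D.target r v q).map fun y => leader (idsAt ids pos y)⟩

theorem report_localView (C : Config V A) (a : A) :
    report (localView D ids r C a) = nodeReport D r ids C.pos (C.pos a) := by
  simp only [report, localView, nodeReport, List.map_ofFn, Function.comp_def, Option.map_map]

theorem some_mem_nodeReport_ports {v : V} {t : Option ℕ} :
    some t ∈ (nodeReport D r ids pos v).ports ↔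
      ∃ y, (D.snapshot r).Adj v y ∧ leader (idsAt ids pos y) = t := by
  simp only [nodeReport, List.mem_ofFn, Option.map_eq_some_iff]
  constructor
  · rintro ⟨q, y, hy, h⟩
    exact ⟨y, target_eq_some D r hy, h⟩
  · rintro ⟨y, hy, h⟩
    obtain ⟨q, hq⟩ := exists_target_eq D r hy
    exact ⟨q, y, hq, h⟩

/-- The first port whose entry in the report is `some t` leads to a node whose leader is `t`. -/
theorem exists_target_idxOf {v : V} {t : Option ℕ}
    (h : some t ∈ (nodeReport D r ids pos v).ports) :
    ∃ y, D.target r v ((nodeReport D r ids pos v).ports.idxOf (some t)) = some y ∧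
      leader (idsAt ids pos y) = t := by
  have hlt := List.idxOf_lt_length_iff.2 h
  have hget := List.getElem_idxOf hlt
  generalize (nodeReport D r ids pos v).ports.idxOf (some t) = q at *
  simpa [nodeReport] using hget

theorem IsLeader.nodeReport_id {a : A} (ha : IsLeader ids pos a) :
    (nodeReport D r ids pos (pos a)).id = ids a := by
  simp only [nodeReport]
  rw [show leader _ = _ from ha]
  rfl

/-- The reports of the occupied nodes. -/
noncomputable def reports (ids : A → ℕ) (pos : A → V) : Multiset Report :=
  (Finset.univ.image pos).val.map (nodeReport D r ids pos)

theorem mem_reports {s : Report} :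
    s ∈ reports D r ids pos ↔ ∃ a, IsLeader ids pos a ∧ s = nodeReport D r ids pos (pos a) := by
  simp only [reports, Multiset.mem_map, Finset.mem_val, Finset.mem_image, Finset.mem_univ,
    true_and]
  constructor
  · rintro ⟨v, hv, rfl⟩
    obtain ⟨a, rfl, ha⟩ := exists_isLeader ids hv
    exact ⟨a, ha, rfl⟩
  · rintro ⟨a, -, rfl⟩
    exact ⟨_, ⟨a, rfl⟩, rfl⟩

/-- Both ends of an edge report it, so the symmetrization in `fromRel` adds nothing; its exclusion
of loops loses nothing because distinct nodes have distinct names. -/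
theorem mapGraph_reports_adj (hids : Function.Injective ids) {i j : ℕ} :
    (mapGraph (reports D r ids pos)).Adj i j ↔
      ∃ a b, IsLeader ids pos a ∧ IsLeader ids pos b ∧ ids a = i ∧ ids b = j ∧
        (D.snapshot r).Adj (pos a) (pos b) := by
  have key : ∀ i j, (∃ s ∈ reports D r ids pos, s.id = i ∧ some (some j) ∈ s.ports) ↔
      ∃ a b, IsLeader ids pos a ∧ IsLeader ids pos b ∧ ids a = i ∧ ids b = j ∧
        (D.snapshot r).Adj (pos a) (pos b) := by
    intro i j
    constructor
    · rintro ⟨s, hs, hi, hj⟩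
      obtain ⟨a, ha, rfl⟩ := (mem_reports D r).1 hs
      obtain ⟨y, hy, hl⟩ := (some_mem_nodeReport_ports D r).1 hj
      obtain ⟨b, rfl, hb, hbj⟩ := exists_isLeader_of_leader_eq hl
      exact ⟨a, b, ha, hb, (ha.nodeReport_id D r).symm.trans hi, hbj, hy⟩
    · rintro ⟨a, b, ha, hb, rfl, rfl, h⟩
      exact ⟨_, (mem_reports D r).2 ⟨a, ha, rfl⟩, ha.nodeReport_id D r,
        (some_mem_nodeReport_ports D r).2 ⟨_, h, hb⟩⟩
  rw [mapGraph, SimpleGraph.fromRel_adj, key, key]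
  constructor
  · rintro ⟨-, h | ⟨a, b, ha, hb, hi, hj, h⟩⟩
    · exact h
    · exact ⟨b, a, hb, ha, hj, hi, h.symm⟩
  · intro h
    refine ⟨?_, Or.inl h⟩
    rintro rfl
    obtain ⟨a, b, ha, hb, hi, hj, h⟩ := h
    rw [← hj] at hi
    exact h.ne (congrArg pos (hids hi))

end Names

/-! ### Decoding the memory -/

theorem idOf_memory (P : Bool) (i : ℕ) : idOf (memory P i) = i := by
  simp only [idOf, memory, List.tail_cons]
  induction i using Nat.binaryRec' with
  | zero => simp
  | bit b n h ih => rw [Nat.bits_append_bit n b h, List.foldr_cons, ih]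

theorem phaseOf_memory (P : Bool) (i : ℕ) : phaseOf (memory P i) = P := rfl

/-! ### Messages and moves in one round -/

section Rounds

variable {V A : Type*} [DecidableEq V] [Fintype A] {ids : A → ℕ}

/-- No agent has terminated and all agents are in phase `P`. -/
structure IsActive (P : Bool) (ids : A → ℕ) (C : Config V A) : Prop where
  halted : ∀ a, C.halted a = false
  mem : ∀ a, C.mem a = memory P (ids a)

variable (D : DynamicGraph V) (r : ℕ) {C : Config V A} {P : Bool}

/-- Every occupied node has exactly one leader. Multiplicities matter here, since the balance test
uses the sum and the number of the reports. -/
theorem reports_eq_map_leaders (hids : Function.Injective ids) (pos : A → V) :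
    reports D r ids pos =
      (Finset.univ.filter (IsLeader ids pos)).val.map fun a => nodeReport D r ids pos (pos a) := by
  have himg : Finset.univ.image pos = (Finset.univ.filter (IsLeader ids pos)).image pos := by
    ext v
    simp only [Finset.mem_image, Finset.mem_univ, true_and, Finset.mem_filter]
    constructor
    · intro h
      obtain ⟨a, ha, hl⟩ := exists_isLeader ids h
      exact ⟨a, hl, ha⟩
    · rintro ⟨a, -, ha⟩
      exact ⟨a, ha⟩
  rw [reports, himg, Finset.image_val_of_injOn, Multiset.map_map]
  · rfl
  · intro a ha b hb hab
    simp only [Finset.coe_filter, Finset.mem_univ, true_and, Set.mem_ofPred_eq] at ha hb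
    exact ha.eq_of_pos_eq hids hb hab

theorem IsActive.messages_eq (hC : IsActive P ids C) (hids : Function.Injective ids) :
    messages fillThenBalance D ids r C = reports D r ids C.pos := by
  classical
  rw [reports_eq_map_leaders D r hids, Finset.filter_val, ← Multiset.filterMap_eq_filter,
    Multiset.map_filterMap]
  unfold messages
  congr 1
  funext a
  rw [hC.halted a, hC.mem a]
  simp only [fillThenBalance, idOf_memory, Bool.false_eq_true, if_false, report_localView]
  have hiff : leader (localView D ids r C a).here = some (ids a) ↔ IsLeader ids C.pos a := Iff.rfl
  by_cases h : IsLeader ids C.pos a <;> simp [Option.guard, hiff, h]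

theorem IsActive.decision_eq (hC : IsActive P ids C) (hids : Function.Injective ids) (a : A) :
    decision fillThenBalance D ids r C a =
      fillThenBalance.act (memory P (ids a)) (localView D ids r C a)
        (reports D r ids C.pos) := by
  rw [decision, hC.halted a, hC.mem a, hC.messages_eq D r hids]
  rfl

/-- The node reached from `v` by an action. -/
noncomputable def moved (v : V) : Action → V
  | Action.move q => (D.target r v q).getD v
  | _ => v

theorem step_pos (alg : Algorithm) (a : A) :
    (step alg D ids r C).pos a = moved D r (C.pos a) (decision alg D ids r C a).2 := rfl

theorem moved_goTo (hids : Function.Injective ids) {a b : A} (hb : IsLeader ids C.pos b)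
    (h : (D.snapshot r).Adj (C.pos a) (C.pos b)) :
    moved D r (C.pos a) (goTo (localView D ids r C a) (ids b)) = C.pos b := by
  obtain ⟨y, hy, hl⟩ := exists_target_idxOf D r
    ((some_mem_nodeReport_ports D r (ids := ids) (pos := C.pos)).2 ⟨_, h, hb⟩)
  rw [goTo, report_localView]
  simp only [moved, hy, Option.getD_some]
  exact (eq_pos_of_leader_eq hids hl).symm

theorem moved_to_hole {a : A}
    (h : some none ∈ (nodeReport D r ids C.pos (C.pos a)).ports) (b : A) :
    C.pos b ≠ moved D r (C.pos a)
      (Action.move ((report (localView D ids r C a)).ports.idxOf (some none))) := by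
  obtain ⟨y, hy, hl⟩ := exists_target_idxOf D r h
  rw [report_localView]
  simp only [moved, hy, Option.getD_some]
  exact leader_idsAt_eq_none.1 hl b

/-- Leaders of occupied nodes that are joined by a path of the map. -/
theorem exists_leaders_of_isPathSeq (hids : Function.Injective ids) {p : List ℕ} {d : ℕ}
    {f : ℕ → ℕ} (h : IsPathSeq (mapGraph (reports D r ids C.pos)) p d f) {a : A}
    (ha : IsLeader ids C.pos a) (h0 : f 0 = ids a) :
    ∃ g : ℕ → A, (∀ i ≤ d, IsLeader ids C.pos (g i) ∧ ids (g i) = f i) ∧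
      ∀ i < d, (D.snapshot r).Adj (C.pos (g i)) (C.pos (g (i + 1))) := by
  have hex : ∀ i, ∃ b, i ≤ d → IsLeader ids C.pos b ∧ ids b = f i := by
    rintro (_ | i)
    · exact ⟨a, fun _ => ⟨ha, h0.symm⟩⟩
    · by_cases hi : i + 1 ≤ d
      · obtain ⟨-, b, -, hb, -, hbf, -⟩ := (mapGraph_reports_adj D r hids).1 (h.adj i hi)
        exact ⟨b, fun _ => ⟨hb, hbf⟩⟩
      · exact ⟨a, fun h => absurd h hi⟩
  choose g hg using hex
  refine ⟨g, hg, fun i hi => ?_⟩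
  obtain ⟨b, b', -, -, hb, hb', hadj⟩ := (mapGraph_reports_adj D r hids).1 (h.adj i hi)
  rw [← (hg i hi.le).2] at hb
  rw [← (hg (i + 1) hi).2] at hb'
  rwa [hids hb, hids hb'] at hadj

/-! ## Filling the holes -/

/-- Follow the walk up to its first hole: all earlier nodes are occupied, hence consecutive ones are
adjacent in the map, and the last of them sees the hole. -/
theorem exists_adj_hole {v h : V} (p : (D.snapshot r).Walk v h) (hh : ∀ b, C.pos b ≠ h)
    (hids : Function.Injective ids) :
    ∀ a, IsLeader ids C.pos a → C.pos a = v →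
      ∃ b, IsLeader ids C.pos b ∧
        (mapGraph (reports D r ids C.pos)).Reachable (ids a) (ids b) ∧
        some none ∈ (nodeReport D r ids C.pos (C.pos b)).ports := by
  induction p with
  | nil => exact fun a _ h => absurd h (hh a)
  | @cons v w _ hvw q ih =>
    rintro a ha rfl
    cases hl : leader (idsAt ids C.pos w) with
    | none =>
      exact ⟨a, ha, .rfl, (some_mem_nodeReport_ports D r).2 ⟨w, hvw, hl⟩⟩
    | some i =>
      obtain ⟨b, rfl, hb, rfl⟩ := exists_isLeader_of_leader_eq hl
      obtain ⟨c, hc, hbc, hp⟩ := ih hh b hb rfl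
      refine ⟨c, hc, SimpleGraph.Reachable.trans (SimpleGraph.Adj.reachable ?_) hbc, hp⟩
      exact (mapGraph_reports_adj D r hids).2 ⟨a, b, ha, hb, rfl, rfl, hvw⟩

/-- Connectivity turns a local observation into a global one: if nobody sees a hole, every node is
occupied. -/
theorem holeSeen_iff [Nonempty A] (hconn : (D.snapshot r).Connected)
    (hids : Function.Injective ids) :
    HoleSeen (reports D r ids C.pos) ↔ ∃ h, ∀ b, C.pos b ≠ h := by
  constructor
  · rintro ⟨s, hs, h⟩
    obtain ⟨a, -, rfl⟩ := (mem_reports D r).1 hs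
    obtain ⟨y, -, hy⟩ := (some_mem_nodeReport_ports D r).1 h
    exact ⟨y, leader_idsAt_eq_none.1 hy⟩
  · rintro ⟨h, hh⟩
    obtain ⟨a, -, ha⟩ := exists_isLeader (pos := C.pos) ids ⟨Classical.arbitrary A, rfl⟩
    obtain ⟨p⟩ := hconn.preconnected (C.pos a) h
    obtain ⟨b, hb, -, hp⟩ := exists_adj_hole D r p hh hids a ha rfl
    exact ⟨_, (mem_reports D r).2 ⟨b, hb, rfl⟩, hp⟩

theorem multinodeSeen_iff (hids : Function.Injective ids) :
    MultinodeSeen (reports D r ids C.pos) ↔ ∃ v, 1 < load C.pos v := by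
  constructor
  · rintro ⟨s, hs, h⟩
    obtain ⟨a, -, rfl⟩ := (mem_reports D r).1 hs
    exact ⟨C.pos a, by rwa [← card_idsAt hids]⟩
  · rintro ⟨v, hv⟩
    obtain ⟨a, rfl, ha⟩ := exists_isLeader ids (load_pos_iff.1 (zero_lt_one.trans hv))
    refine ⟨_, (mem_reports D r).2 ⟨a, ha, rfl⟩, ?_⟩
    rwa [← card_idsAt hids] at hv

theorem IsActive.step_halt_pos (hC : IsActive P ids C) (hids : Function.Injective ids)
    (h : ∀ a, ∃ m, fillThenBalance.act (memory P (ids a)) (localView D ids r C a)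
      (reports D r ids C.pos) = (m, Action.halt)) :
    (∀ a, (step fillThenBalance D ids r C).halted a = true) ∧
      (step fillThenBalance D ids r C).pos = C.pos := by
  constructor
  · intro a
    obtain ⟨m, hm⟩ := h a
    simp only [step, hC.decision_eq D r hids a, hm]
  · funext a
    obtain ⟨m, hm⟩ := h a
    simp only [step, hC.decision_eq D r hids a, hm]

/-- The place of an agent after a sliding round. -/
theorem IsActive.slide_step_pos (hC : IsActive false ids C) (hids : Function.Injective ids)
    (hH : HoleSeen (reports D r ids C.pos)) (hM : MultinodeSeen (reports D r ids C.pos)) (a : A) :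
    (step fillThenBalance D ids r C).pos a = moved D r (C.pos a)
      (if IsLeader ids C.pos a then
        slideAction (ids a) (localView D ids r C a) (reports D r ids C.pos) else Action.stay) := by
  rw [step_pos, hC.decision_eq D r hids]
  simp only [fillThenBalance, phaseOf_memory, idOf_memory, if_pos hH, if_pos hM, if_true]
  exact congrArg _ (if_congr Iff.rfl rfl rfl)

theorem IsActive.slide_step_active (hC : IsActive false ids C) (hids : Function.Injective ids)
    (hH : HoleSeen (reports D r ids C.pos)) (hM : MultinodeSeen (reports D r ids C.pos)) :
    IsActive false ids (step fillThenBalance D ids r C) := by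
  constructor
  · intro a
    simp only [step, hC.decision_eq D r hids]
    simp only [fillThenBalance, phaseOf_memory, idOf_memory, if_pos hH, if_pos hM, if_true]
    unfold slideAction
    split_ifs
    · cases nextOn (slidePath (reports D r ids C.pos) (ids a)) (ids a) <;> rfl
    · rfl
    · rfl
  · intro a
    simp only [step, hC.decision_eq D r hids]
    simp only [fillThenBalance, phaseOf_memory, if_pos hH, if_pos hM, if_true]

end Rounds

section Rounds

variable {V A : Type*} [DecidableEq V] [Fintype A] {ids : A → ℕ}
variable (D : DynamicGraph V) (r : ℕ) {C : Config V A}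

/-- The slide path through the node of a leader, as a sequence of leaders. -/
theorem exists_leaders_of_slidePath (hids : Function.Injective ids) {z : ℕ}
    (h : ∃ d u v, IsSlide (reports D r ids C.pos) z d u v) :
    ∃ d f, ∃ g : ℕ → A,
      IsPathSeq (mapGraph (reports D r ids C.pos)) (slidePath (reports D r ids C.pos) z) d f ∧
      (∀ i ≤ d, IsLeader ids C.pos (g i) ∧ ids (g i) = f i) ∧
      (∀ i < d, (D.snapshot r).Adj (C.pos (g i)) (C.pos (g (i + 1)))) ∧
      (∀ i ≤ d, slidePath (reports D r ids C.pos) (f i) = slidePath (reports D r ids C.pos) z) ∧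
      1 < load C.pos (C.pos (g 0)) ∧
      some none ∈ (nodeReport D r ids C.pos (C.pos (g d))).ports := by
  obtain ⟨l, u, v, ⟨hzu, huv, -, ⟨s, hs, rfl, hload⟩, ⟨t, ht, rfl, hport⟩⟩, hp⟩ :=
    exists_slidePath_eq h
  obtain ⟨d, f, hf, h0, hd⟩ := exists_isPathSeq_shortestPath huv
  rw [← hp] at hf
  obtain ⟨a, ha, rfl⟩ := (mem_reports D r).1 hs
  obtain ⟨b, hb, rfl⟩ := (mem_reports D r).1 ht
  rw [ha.nodeReport_id] at h0
  rw [hb.nodeReport_id] at hd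
  rw [ha.nodeReport_id, ← h0] at hzu
  obtain ⟨g, hg, hadj⟩ := exists_leaders_of_isPathSeq D r hids hf ha h0
  have hga : g 0 = a := hids ((hg 0 (Nat.zero_le d)).2.trans h0)
  have hgb : g d = b := hids ((hg d le_rfl).2.trans hd)
  refine ⟨d, f, g, hf, hg, hadj, fun i hi => ?_, ?_, ?_⟩
  · exact (slidePath_congr (hzu.trans (hf.reachable hi))).symm
  · rw [hga, ← card_idsAt hids]
    exact hload
  · rwa [hgb]

/-- Occupied nodes stay occupied: off the path the leader does not move, the start of the path is a
multinode, and any later path node is entered by the leader of its predecessor. -/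
theorem IsActive.exists_slide_step_pos_eq (hC : IsActive false ids C)
    (hids : Function.Injective ids)
    (hH : HoleSeen (reports D r ids C.pos)) (hM : MultinodeSeen (reports D r ids C.pos)) {v : V}
    (hv : ∃ a, C.pos a = v) : ∃ b, (step fillThenBalance D ids r C).pos b = v := by
  obtain ⟨a, rfl, ha⟩ := exists_isLeader ids hv
  by_cases hmem : ids a ∈ slidePath (reports D r ids C.pos) (ids a)
  · have hex : ∃ d u v, IsSlide (reports D r ids C.pos) (ids a) d u v := by
      by_contra hcon
      simp [slidePath_eq_nil hcon] at hmem
    obtain ⟨d, f, g, hf, hg, hadj, hcongr, hload, -⟩ := exists_leaders_of_slidePath D r hids hex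
    obtain ⟨i, hi, hia⟩ := hf.mem_iff.1 hmem
    have hga : g i = a := hids ((hg i hi).2.trans hia)
    subst hga
    rcases i with _ | i
    -- Of two agents at the start, one is not the leader and therefore stays.
    · obtain ⟨b, hb, c, hc, hbc⟩ := Finset.one_lt_card.1 hload
      simp only [Finset.mem_filter, Finset.mem_univ, true_and] at hb hc
      have : ∃ b, C.pos b = C.pos (g 0) ∧ b ≠ g 0 := by
        by_cases h : b = g 0
        · exact ⟨c, hc, fun h' => hbc (h.trans h'.symm)⟩
        · exact ⟨b, hb, h⟩
      obtain ⟨b, hb, hne⟩ := this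
      refine ⟨b, ?_⟩
      rw [hC.slide_step_pos D r hids hH hM,
        if_neg fun hl => hne (IsLeader.eq_of_pos_eq hids hl ha hb)]
      exact hb
    -- The leader of the preceding path node computes the same path (`hcongr`) and moves here.
    · refine ⟨g i, ?_⟩
      have hi' : i < d := hi
      obtain ⟨hl, hgi⟩ := hg i hi'.le
      rw [hC.slide_step_pos D r hids hH hM, if_pos hl, slideAction, hgi, hcongr i hi'.le,
        if_pos (hf.mem_iff.2 ⟨i, hi'.le, rfl⟩), hf.nextOn_apply hi', ← (hg (i + 1) hi).2]
      exact moved_goTo D r hids ha (hadj i hi')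
  · refine ⟨a, ?_⟩
    rw [hC.slide_step_pos D r hids hH hM, if_pos ha, slideAction, if_neg hmem]
    rfl

/-- The last leader of a single slide suffices. Slides of different components may enter the same
hole, which is harmless, as only one newly occupied node is needed. -/
theorem IsActive.exists_slide_step_pos_hole [Nonempty A] (hC : IsActive false ids C)
    (hids : Function.Injective ids) (hconn : (D.snapshot r).Connected)
    (hH : HoleSeen (reports D r ids C.pos)) (hM : MultinodeSeen (reports D r ids C.pos)) :
    ∃ b, ∀ a, C.pos a ≠ (step fillThenBalance D ids r C).pos b := by
  obtain ⟨h, hh⟩ := (holeSeen_iff D r hconn hids).1 hH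
  obtain ⟨s, hs, hload⟩ := hM
  obtain ⟨a, ha, rfl⟩ := (mem_reports D r).1 hs
  obtain ⟨p⟩ := hconn.preconnected (C.pos a) h
  obtain ⟨b, hb, hab, hport⟩ := exists_adj_hole D r p hh hids a ha rfl
  have hex : ∃ d u v, IsSlide (reports D r ids C.pos) (ids a) d u v :=
    ⟨_, ids a, ids b, .rfl, hab, rfl, ⟨_, hs, ha.nodeReport_id D r, hload⟩,
      ⟨_, (mem_reports D r).2 ⟨b, hb, rfl⟩, hb.nodeReport_id D r, hport⟩⟩
  obtain ⟨d, f, g, hf, hg, -, hcongr, -, hlast⟩ := exists_leaders_of_slidePath D r hids hex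
  obtain ⟨hl, hgd⟩ := hg d le_rfl
  refine ⟨g d, fun c => ?_⟩
  rw [hC.slide_step_pos D r hids hH ⟨_, hs, hload⟩, if_pos hl, slideAction, hgd,
    hcongr d le_rfl, if_pos (hf.mem_iff.2 ⟨d, le_rfl, rfl⟩), hf.nextOn_last]
  exact moved_to_hole D r hlast c

theorem IsActive.card_image_lt [Nonempty A] (hC : IsActive false ids C)
    (hids : Function.Injective ids) (hconn : (D.snapshot r).Connected)
    (hH : HoleSeen (reports D r ids C.pos)) (hM : MultinodeSeen (reports D r ids C.pos)) :
    (Finset.univ.image C.pos).card <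
      (Finset.univ.image (step fillThenBalance D ids r C).pos).card := by
  apply Finset.card_lt_card
  rw [Finset.ssubset_iff_of_subset]
  · obtain ⟨b, hb⟩ := hC.exists_slide_step_pos_hole D r hids hconn hH hM
    exact ⟨_, Finset.mem_image_of_mem _ (Finset.mem_univ b), by simpa using hb⟩
  · intro v hv
    simpa using hC.exists_slide_step_pos_eq D r hids hH hM (by simpa using hv)

/-! ## Balancing the loads -/

theorem IsActive.balance_step_pos (hC : IsActive true ids C) (hids : Function.Injective ids)
    (hB : ¬ LoadsBalanced (reports D r ids C.pos)) (a : A) :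
    (step fillThenBalance D ids r C).pos a = moved D r (C.pos a)
      (if IsLeader ids C.pos a then
        balanceAction (ids a) (localView D ids r C a) (reports D r ids C.pos)
        else Action.stay) := by
  rw [step_pos, hC.decision_eq D r hids]
  simp only [fillThenBalance, phaseOf_memory, idOf_memory, if_neg hB, Bool.true_eq_false, if_false]
  exact congrArg _ (if_congr Iff.rfl rfl rfl)

theorem IsActive.balance_step_active (hC : IsActive true ids C) (hids : Function.Injective ids)
    (hB : ¬ LoadsBalanced (reports D r ids C.pos)) :
    IsActive true ids (step fillThenBalance D ids r C) := by
  constructor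
  · intro a
    simp only [step, hC.decision_eq D r hids]
    simp only [fillThenBalance, phaseOf_memory, idOf_memory, if_neg hB, Bool.true_eq_false,
      if_false]
    unfold balanceAction
    split_ifs
    · cases nextOn (shortestPath (mapGraph (reports D r ids C.pos))
        (firstWithLoad (reports D r ids C.pos) (maxLoad (reports D r ids C.pos)))
        (firstWithLoad (reports D r ids C.pos) (minLoad (reports D r ids C.pos)))) (ids a) <;> rfl
    · rfl
  · intro a
    simp only [step, hC.decision_eq D r hids]
    simp only [fillThenBalance, phaseOf_memory, if_neg hB, Bool.true_eq_false, if_false]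

/-- Without holes, every step of a walk in the snapshot is an edge of the map. -/
theorem mapGraph_reachable_of_walk (hids : Function.Injective ids)
    (hocc : ∀ v, ∃ a, C.pos a = v) {v w : V} (p : (D.snapshot r).Walk v w) :
    ∀ a b, IsLeader ids C.pos a → IsLeader ids C.pos b → C.pos a = v → C.pos b = w →
      (mapGraph (reports D r ids C.pos)).Reachable (ids a) (ids b) := by
  induction p with
  | nil =>
    rintro a b ha hb rfl h
    rw [ha.eq_of_pos_eq hids hb h.symm]
  | @cons v w _ hvw q ih =>
    rintro a b ha hb rfl h
    obtain ⟨c, rfl, hc⟩ := exists_isLeader ids (hocc w)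
    refine SimpleGraph.Reachable.trans (SimpleGraph.Adj.reachable ?_) (ih c b hc hb rfl h)
    exact (mapGraph_reports_adj D r hids).2 ⟨a, c, ha, hc, rfl, rfl, hvw⟩

/-- If a set of agents moves along a path, each to the place of the next one, only the loads of the
ends of the path change. -/
theorem load_eq_of_shift {pos pos' : A → V} {d : ℕ} {g : ℕ → A}
    (hinj : ∀ i ≤ d, ∀ j ≤ d, g i = g j → i = j)
    (hmove : ∀ i < d, pos' (g i) = pos (g (i + 1)))
    (hstay : ∀ a, (∀ i < d, g i ≠ a) → pos' a = pos a) (v : V) :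
    (load pos' v : ℤ) = load pos v + (if pos (g d) = v then 1 else 0)
      - (if pos (g 0) = v then 1 else 0) := by
  classical
  let e : A → ℤ := fun a => (if pos' a = v then 1 else 0) - (if pos a = v then 1 else 0)
  have h1 : (load pos' v : ℤ) - load pos v = ∑ a, e a := by
    simp only [e, load, Finset.sum_sub_distrib, Finset.card_filter]
    push_cast
    rfl
  have h2 : ∑ a, e a = ∑ a ∈ (Finset.range d).image g, e a := by
    refine (Finset.sum_subset (Finset.subset_univ _) fun a _ ha => ?_).symm
    have : pos' a = pos a := hstay a fun i hi hia =>
      ha (Finset.mem_image.2 ⟨i, Finset.mem_range.2 hi, hia⟩)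
    simp [e, this]
  have h3 : ∑ a ∈ (Finset.range d).image g, e a = ∑ i ∈ Finset.range d, e (g i) := by
    refine Finset.sum_image fun i hi j hj hij => ?_
    simp only [Finset.coe_range, Set.mem_Iio] at hi hj
    exact hinj i hi.le j hj.le hij
  have h4 : ∑ i ∈ Finset.range d, e (g i) = ∑ i ∈ Finset.range d,
      ((if pos (g (i + 1)) = v then 1 else 0) - (if pos (g i) = v then 1 else 0) : ℤ) :=
    Finset.sum_congr rfl fun i hi => by simp only [e, hmove i (Finset.mem_range.1 hi)]
  -- The sum telescopes, leaving only the two ends of the path.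
  rw [Finset.sum_range_sub (fun i => (if pos (g i) = v then 1 else 0 : ℤ))] at h4
  linarith

theorem exists_load_eq_iff (hids : Function.Injective ids) {m : ℕ} :
    (∃ s ∈ reports D r ids C.pos, s.load = m) ↔ ∃ a, load C.pos (C.pos a) = m := by
  constructor
  · rintro ⟨s, hs, rfl⟩
    obtain ⟨a, -, rfl⟩ := (mem_reports D r).1 hs
    exact ⟨a, (card_idsAt hids _).symm⟩
  · rintro ⟨a, rfl⟩
    obtain ⟨b, hb, hl⟩ := exists_isLeader (pos := C.pos) ids ⟨a, rfl⟩
    exact ⟨_, (mem_reports D r).2 ⟨b, hl, rfl⟩, by rw [hb]; exact card_idsAt hids _⟩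

theorem le_maxLoad (hids : Function.Injective ids) (a : A) :
    load C.pos (C.pos a) ≤ maxLoad (reports D r ids C.pos) := by
  obtain ⟨s, hs, h⟩ := (exists_load_eq_iff D r hids).2 ⟨a, rfl⟩
  rw [← h]
  exact Multiset.le_sup (Multiset.mem_map_of_mem _ hs)

theorem minLoad_le (hids : Function.Injective ids) (a : A) :
    minLoad (reports D r ids C.pos) ≤ load C.pos (C.pos a) :=
  Nat.sInf_le ((exists_load_eq_iff D r hids).2 ⟨a, rfl⟩)

theorem exists_load_eq_maxLoad [Nonempty A] (hids : Function.Injective ids) :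
    ∃ s ∈ reports D r ids C.pos, s.load = maxLoad (reports D r ids C.pos) := by
  rw [exists_load_eq_iff D r hids]
  obtain ⟨a, ha⟩ := Finite.exists_max fun a => load C.pos (C.pos a)
  refine ⟨a, le_antisymm (le_maxLoad D r hids a) (Multiset.sup_le.2 fun m hm => ?_)⟩
  obtain ⟨s, hs, rfl⟩ := Multiset.mem_map.1 hm
  obtain ⟨b, hb⟩ := (exists_load_eq_iff D r hids).1 ⟨s, hs, rfl⟩
  exact hb ▸ ha b

theorem exists_load_eq_minLoad [Nonempty A] (hids : Function.Injective ids) :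
    ∃ s ∈ reports D r ids C.pos, s.load = minLoad (reports D r ids C.pos) :=
  Nat.sInf_mem (s := {m | ∃ s ∈ reports D r ids C.pos, s.load = m})
    ⟨_, (exists_load_eq_iff D r hids).2 ⟨Classical.arbitrary A, rfl⟩⟩

theorem exists_leader_firstWithLoad (hids : Function.Injective ids) {m : ℕ}
    (h : ∃ s ∈ reports D r ids C.pos, s.load = m) :
    ∃ a, IsLeader ids C.pos a ∧ ids a = firstWithLoad (reports D r ids C.pos) m ∧
      load C.pos (C.pos a) = m := by
  obtain ⟨s₀, hs₀, hm⟩ := h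
  obtain ⟨s, hs, hid, hload⟩ := Nat.sInf_mem
    (s := {i | ∃ s ∈ reports D r ids C.pos, s.id = i ∧ s.load = m}) ⟨_, s₀, hs₀, rfl, hm⟩
  obtain ⟨a, ha, rfl⟩ := (mem_reports D r).1 hs
  exact ⟨a, ha, (ha.nodeReport_id D r).symm.trans hid, (card_idsAt hids _).symm.trans hload⟩

/-- In a balancing round, one unit of load is transferred from a node of maximal load to a node of
minimal load. -/
theorem IsActive.exists_balance_step_load [Nonempty A] (hC : IsActive true ids C)
    (hids : Function.Injective ids) (hconn : (D.snapshot r).Connected)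
    (hocc : ∀ v, ∃ a, C.pos a = v) (hB : ¬ LoadsBalanced (reports D r ids C.pos)) :
    ∃ x y, (∀ v, load C.pos v ≤ load C.pos x) ∧ (∀ v, load C.pos y ≤ load C.pos v) ∧
      ∀ v, (load (step fillThenBalance D ids r C).pos v : ℤ) =
        load C.pos v + (if y = v then 1 else 0) - (if x = v then 1 else 0) := by
  obtain ⟨a, ha, ha', hmax⟩ := exists_leader_firstWithLoad D r hids
    (exists_load_eq_maxLoad D r (C := C) hids)
  obtain ⟨b, hb, hb', hmin⟩ := exists_leader_firstWithLoad D r hids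
    (exists_load_eq_minLoad D r (C := C) hids)
  obtain ⟨p⟩ := hconn.preconnected (C.pos a) (C.pos b)
  obtain ⟨d, f, hf, h0, hd⟩ := exists_isPathSeq_shortestPath
    (mapGraph_reachable_of_walk D r hids hocc p a b ha hb rfl rfl)
  obtain ⟨g, hg, hadj⟩ := exists_leaders_of_isPathSeq D r hids hf ha h0
  have hga : g 0 = a := hids ((hg 0 (Nat.zero_le d)).2.trans h0)
  have hgb : g d = b := hids ((hg d le_rfl).2.trans hd)
  refine ⟨C.pos a, C.pos b, fun v => ?_, fun v => ?_, ?_⟩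
  · obtain ⟨c, rfl⟩ := hocc v
    exact hmax ▸ le_maxLoad D r hids c
  · obtain ⟨c, rfl⟩ := hocc v
    exact hmin ▸ minLoad_le D r hids c
  rw [← hga, ← hgb]
  refine load_eq_of_shift (fun i hi j hj hij => ?_) (fun i hi => ?_) fun c hc => ?_
  · exact hf.inj i hi j hj (by rw [← (hg i hi).2, ← (hg j hj).2, hij])
  · rw [hC.balance_step_pos D r hids hB, if_pos (hg i hi.le).1, balanceAction, ← ha', ← hb',
      (hg i hi.le).2, hf.nextOn_apply hi, ← (hg (i + 1) hi).2]
    exact moved_goTo D r hids (hg (i + 1) hi).1 (hadj i hi)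
  · rw [hC.balance_step_pos D r hids hB]
    split_ifs with hl
    -- A leader that is none of `g 0, …, g (d - 1)` is the end of the path or off it; in both cases
    -- it has no successor and stays.
    · have : nextOn (shortestPath (mapGraph (reports D r ids C.pos)) (ids a) (ids b)) (ids c)
          = none := by
        by_cases hmem : ids c ∈ shortestPath (mapGraph (reports D r ids C.pos)) (ids a) (ids b)
        · obtain ⟨i, hi, hic⟩ := hf.mem_iff.1 hmem
          rcases hi.lt_or_eq with h | rfl
          · exact absurd (hids ((hg i hi).2.trans hic)) (hc i h)
          · rw [← hic, hf.nextOn_last]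
        · exact IsPathSeq.nextOn_of_notMem hmem
      rw [balanceAction, ← ha', ← hb', this]
      rfl
    · rfl

variable [Fintype V]

theorem reports_eq_of_forall_occupied (hocc : ∀ v, ∃ a, C.pos a = v) :
    reports D r ids C.pos = (Finset.univ : Finset V).val.map (nodeReport D r ids C.pos) := by
  rw [reports, Finset.image_univ_of_surjective hocc]

/-- With all nodes occupied there are `n` reports of total load `k`, so the agents test the true
average although they know neither number. -/
theorem loadsBalanced_reports_iff [Nonempty A] (hids : Function.Injective ids)
    (hocc : ∀ v, ∃ a, C.pos a = v) :
    LoadsBalanced (reports D r ids C.pos) ↔ IsBalanced C.pos := by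
  have hsum : ((reports D r ids C.pos).map Report.load).sum = Fintype.card A := by
    rw [reports_eq_of_forall_occupied D r hocc, Multiset.map_map, ← sum_load C.pos]
    simp only [Function.comp_def, nodeReport, card_idsAt hids]
    rfl
  have hcard : (reports D r ids C.pos).card = Fintype.card V := by
    rw [reports_eq_of_forall_occupied D r hocc, Multiset.card_map]
    rfl
  obtain ⟨a, ha⟩ := (exists_load_eq_iff D r hids).1 (exists_load_eq_maxLoad D r (C := C) hids)
  obtain ⟨b, hb⟩ := (exists_load_eq_iff D r hids).1 (exists_load_eq_minLoad D r (C := C) hids)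
  rw [LoadsBalanced, hsum, hcard]
  constructor
  · rintro ⟨h1, h2⟩ v
    obtain ⟨c, rfl⟩ := hocc v
    exact ⟨h1.trans (minLoad_le D r hids c), (le_maxLoad D r hids c).trans h2⟩
  · intro h
    exact ⟨hb ▸ (h _).1, ha ▸ (h _).2⟩

end Rounds

/-! ## Termination -/

section Imbalance

variable {V : Type*} [Fintype V]

/-- The total distance of the loads from the interval `[f, c]`. -/
def imbalance (f c : ℕ) (L : V → ℕ) : ℕ := ∑ v, ((L v - c) + (f - L v))

theorem imbalance_le (f c : ℕ) (L : V → ℕ) :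
    imbalance f c L ≤ ∑ v, L v + Fintype.card V * f := by
  rw [imbalance, Finset.sum_add_distrib]
  refine Nat.add_le_add (Finset.sum_le_sum fun v _ => Nat.sub_le _ _) ?_
  refine (Finset.sum_le_sum fun v _ => Nat.sub_le f _).trans ?_
  simp

/-- Averaging: if some load is below `f`, not all loads can be at most `f`; if some load is above
`c`, not all can be at least `c`. -/
theorem max_min_of_not_balanced {f c : ℕ} {L : V → ℕ} {x y : V}
    (hf : Fintype.card V * f ≤ ∑ v, L v) (hc : ∑ v, L v ≤ Fintype.card V * c) (hfc : f ≤ c)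
    (hx : ∀ v, L v ≤ L x) (hy : ∀ v, L y ≤ L v) (hL : ¬ ∀ v, f ≤ L v ∧ L v ≤ c) :
    f < L x ∧ L y < c ∧ (c < L x ∨ L y < f) := by
  push Not at hL
  obtain ⟨v, hv⟩ := hL
  by_cases hvf : L v < f
  · have h1 : L y < f := (hy v).trans_lt hvf
    refine ⟨?_, h1.trans_le hfc, Or.inr h1⟩
    by_contra hcon
    have : ∑ v, L v < ∑ _v : V, f :=
      Finset.sum_lt_sum (fun w _ => (hx w).trans (not_lt.1 hcon)) ⟨v, Finset.mem_univ v, hvf⟩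
    simp at this
    omega
  · have hvc := hv (not_lt.1 hvf)
    have h1 : c < L x := hvc.trans_le (hx v)
    refine ⟨hfc.trans_lt h1, ?_, Or.inl h1⟩
    by_contra hcon
    have : ∑ _v : V, c < ∑ v, L v :=
      Finset.sum_lt_sum (fun w _ => (not_lt.1 hcon).trans (hy w)) ⟨v, Finset.mem_univ v, hvc⟩
    simp at this
    omega

/-- `f < L x` prevents a new deficit at `x` and `L y < c` a new excess at `y`; by `hxy` at least one
end lies outside the interval and gets closer to it. -/
theorem imbalance_lt_of_transfer [DecidableEq V] {f c : ℕ} {L L' : V → ℕ} {x y : V}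
    (hfx : f < L x) (hyc : L y < c) (hxy : c < L x ∨ L y < f)
    (hL' : ∀ v, (L' v : ℤ) = L v + (if y = v then 1 else 0) - (if x = v then 1 else 0)) :
    imbalance f c L' < imbalance f c L := by
  have hne : x ≠ y := by
    rintro rfl
    omega
  have h1 : L' x + 1 = L x := by
    have := hL' x
    simp only [hne.symm, if_false, if_true] at this
    omega
  have h2 : L' y = L y + 1 := by
    have := hL' y
    simp only [hne, if_false, if_true] at this
    omega
  refine Finset.sum_lt_sum (fun v _ => ?_) ?_
  · by_cases hvx : v = x
    · subst hvx
      omega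
    by_cases hvy : v = y
    · subst hvy
      omega
    have := hL' v
    simp only [Ne.symm hvx, Ne.symm hvy, if_false] at this
    omega
  · rcases hxy with h | h
    · exact ⟨x, Finset.mem_univ x, by omega⟩
    · exact ⟨y, Finset.mem_univ y, by omega⟩

end Imbalance

/-! ### Memory bound and round budget -/

section Main

variable {V A : Type*} [DecidableEq V] [Fintype A] {ids : A → ℕ}

theorem exists_mem_eq_memory (D : DynamicGraph V) (start : A → V) (r : ℕ) (a : A) :
    ∃ P, (run fillThenBalance D ids start r).mem a = memory P (ids a) := by
  induction r with
  | zero => exact ⟨false, rfl⟩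
  | succ r ih =>
    obtain ⟨P, hP⟩ := ih
    simp only [run, step, decision]
    generalize run fillThenBalance D ids start r = C at *
    split_ifs
    · exact ⟨P, hP⟩
    · rw [hP]
      simp only [fillThenBalance]
      split_ifs <;> first | exact ⟨P, rfl⟩ | exact ⟨true, by rw [idOf_memory]⟩

theorem memory_length_le {n c i : ℕ} (P : Bool) (hi : i ≤ n ^ c) :
    (memory P i).length ≤ (c + 2) * (Nat.log 2 n + 1) := by
  have h1 : i.size ≤ c * (Nat.log 2 n + 1) + 1 := by
    rw [Nat.size_le]
    calc i ≤ n ^ c := hi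
      _ ≤ (2 ^ (Nat.log 2 n + 1)) ^ c :=
        Nat.pow_le_pow_left (Nat.lt_pow_succ_log_self one_lt_two n).le c
      _ = 2 ^ (c * (Nat.log 2 n + 1)) := by rw [← pow_mul, mul_comm]
      -- The size bound needs strict inequality, which would fail without the extra bit for `c = 0`
      -- and `i = 1`. This bit and the phase bit account for the `2` in `c + 2`.
      _ < 2 ^ (c * (Nat.log 2 n + 1) + 1) := Nat.pow_lt_pow_right one_lt_two (Nat.lt_succ_self _)
  rw [memory, List.length_cons, Nat.size_eq_bits_len]
  nlinarith

variable [Fintype V]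

/-- The loads are at total distance `loadImbalance pos` from balanced dispersion. -/
noncomputable def loadImbalance (pos : A → V) : ℕ :=
  imbalance ⌊(Fintype.card A : ℚ) / Fintype.card V⌋₊ ⌈(Fintype.card A : ℚ) / Fintype.card V⌉₊
    (load pos)

omit [DecidableEq V] in
theorem card_mul_floor_le :
    Fintype.card V * ⌊(Fintype.card A : ℚ) / Fintype.card V⌋₊ ≤ Fintype.card A := by
  rw [Nat.floor_div_eq_div]
  exact Nat.mul_div_le _ _

omit [DecidableEq V] in
theorem le_card_mul_ceil [Nonempty V] :
    Fintype.card A ≤ Fintype.card V * ⌈(Fintype.card A : ℚ) / Fintype.card V⌉₊ := by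
  have h := Nat.le_ceil ((Fintype.card A : ℚ) / Fintype.card V)
  rw [div_le_iff₀ (by exact_mod_cast Fintype.card_pos)] at h
  rw [mul_comm]
  exact_mod_cast h

/-- The total excess is at most the total load `k`, and the total deficit at most `n * ⌊k/n⌋ ≤ k`.
-/
theorem loadImbalance_le (pos : A → V) : loadImbalance pos ≤ 2 * Fintype.card A := by
  have h1 := imbalance_le ⌊(Fintype.card A : ℚ) / Fintype.card V⌋₊
    ⌈(Fintype.card A : ℚ) / Fintype.card V⌉₊ (load pos)
  have h2 := card_mul_floor_le (V := V) (A := A)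
  rw [sum_load] at h1
  rw [loadImbalance]
  omega

/-- A dispersed configuration with a hole is balanced. -/
theorem isBalanced_of_hole [Nonempty A] {pos : A → V} {h : V} (hh : ∀ a, pos a ≠ h)
    (hM : ¬ ∃ v, 1 < load pos v) : IsBalanced pos := by
  simp only [not_exists, not_lt] at hM
  have hlt : Fintype.card A < Fintype.card V := by
    rw [← sum_load pos, ← Finset.card_univ, Finset.card_eq_sum_ones]
    refine Finset.sum_lt_sum (fun v _ => hM v) ⟨h, Finset.mem_univ h, ?_⟩
    by_contra hcon
    obtain ⟨a, ha⟩ := load_pos_iff.1 (zero_lt_one.trans_le (not_lt.1 hcon))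
    exact hh a ha
  intro v
  -- Since `0 < k < n`, the floor is `0` and the ceiling is at least `1`.
  refine ⟨?_, (hM v).trans (Nat.one_le_ceil_iff.2 ?_)⟩
  · rw [Nat.floor_div_eq_div, Nat.div_eq_of_lt hlt]
    exact Nat.zero_le _
  · have h1 : 0 < Fintype.card A := Fintype.card_pos
    have h2 : 0 < Fintype.card V := h1.trans hlt
    positivity

/-- The configurations that occur in an execution with at most `m` rounds to go. -/
def IsProper (ids : A → ℕ) (m : ℕ) (C : Config V A) : Prop :=
  (IsActive false ids C ∧
    (Fintype.card A - (Finset.univ.image C.pos).card) + 2 * Fintype.card A + 2 ≤ m) ∨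
  (IsActive true ids C ∧ (∀ v, ∃ a, C.pos a = v) ∧ loadImbalance C.pos + 1 ≤ m) ∨
  ((∀ a, C.halted a = true) ∧ IsBalanced C.pos)

variable (D : DynamicGraph V) (r : ℕ) {C : Config V A} {m : ℕ}

theorem IsActive.isProper_step_false [Nonempty A] (hC : IsActive false ids C)
    (hids : Function.Injective ids) (hconn : (D.snapshot r).Connected)
    (hm : (Fintype.card A - (Finset.univ.image C.pos).card) + 2 * Fintype.card A + 2 ≤ m) :
    IsProper ids (m - 1) (step fillThenBalance D ids r C) := by
  by_cases hH : HoleSeen (reports D r ids C.pos)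
  · by_cases hM : MultinodeSeen (reports D r ids C.pos)
    · refine Or.inl ⟨hC.slide_step_active D r hids hH hM, ?_⟩
      have h1 := hC.card_image_lt D r hids hconn hH hM
      -- This bound makes the truncated difference in the budget drop strictly.
      have h2 : (Finset.univ.image (step fillThenBalance D ids r C).pos).card ≤ Fintype.card A :=
        Finset.card_image_le
      omega
    · obtain ⟨h1, h2⟩ := hC.step_halt_pos D r hids fun a => ⟨memory false (ids a), by
        simp only [fillThenBalance, phaseOf_memory, if_true, if_pos hH, if_neg hM]⟩
      obtain ⟨h, hh⟩ := (holeSeen_iff D r hconn hids).1 hH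
      refine Or.inr (Or.inr ⟨h1, ?_⟩)
      rw [h2]
      exact isBalanced_of_hole hh (by rwa [multinodeSeen_iff D r hids] at hM)
  · have hdec : ∀ a, decision fillThenBalance D ids r C a = (memory true (ids a), Action.stay) := by
      intro a
      rw [hC.decision_eq D r hids]
      simp only [fillThenBalance, phaseOf_memory, if_true, if_neg hH, idOf_memory]
    have hpos : (step fillThenBalance D ids r C).pos = C.pos := by
      funext a
      simp only [step, hdec]
    refine Or.inr (Or.inl ⟨⟨fun a => ?_, fun a => ?_⟩, ?_, ?_⟩)
    · simp only [step, hdec]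
    · simp only [step, hdec]
    · rw [hpos]
      simpa [holeSeen_iff D r hconn hids] using hH
    -- The reserve `2k + 2` pays for this switching round, up to `2k` balancing rounds and the
    -- terminating round.
    · have := loadImbalance_le (step fillThenBalance D ids r C).pos
      omega

theorem IsActive.isProper_step_true [Nonempty A] (hC : IsActive true ids C)
    (hids : Function.Injective ids) (hconn : (D.snapshot r).Connected)
    (hocc : ∀ v, ∃ a, C.pos a = v) (hm : loadImbalance C.pos + 1 ≤ m) :
    IsProper ids (m - 1) (step fillThenBalance D ids r C) := by
  by_cases hB : LoadsBalanced (reports D r ids C.pos)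
  · obtain ⟨h1, h2⟩ := hC.step_halt_pos D r hids fun a => ⟨memory true (ids a), by
      simp only [fillThenBalance, phaseOf_memory, Bool.true_eq_false, if_false, if_pos hB]⟩
    refine Or.inr (Or.inr ⟨h1, ?_⟩)
    rw [h2]
    exact (loadsBalanced_reports_iff D r hids hocc).1 hB
  · have : Nonempty V := ⟨C.pos (Classical.arbitrary A)⟩
    obtain ⟨x, y, hx, hy, hL⟩ := hC.exists_balance_step_load D r hids hconn hocc hB
    rw [loadsBalanced_reports_iff D r hids hocc] at hB
    obtain ⟨hfx, hyc, hxy⟩ := max_min_of_not_balanced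
      (by rw [sum_load C.pos]; exact card_mul_floor_le)
      (by rw [sum_load C.pos]; exact le_card_mul_ceil) (Nat.floor_le_ceil _) hx hy hB
    refine Or.inr (Or.inl ⟨hC.balance_step_active D r hids
      (by rwa [loadsBalanced_reports_iff D r hids hocc]), fun v => ?_, ?_⟩)
    -- No hole reappears: the load of `y` is at least `1`, so `hfx`, `hyc` and `hxy` force the load
    -- of `x` to be at least `3`.
    · have h1 := load_pos_iff.2 (hocc v)
      have h2 := load_pos_iff.2 (hocc y)
      have h3 := hL v
      refine load_pos_iff.1 ?_
      by_cases hxv : x = v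
      · subst hxv
        rw [if_pos rfl] at h3
        split_ifs at h3 <;> omega
      · rw [if_neg hxv] at h3
        split_ifs at h3 <;> omega
    · have : loadImbalance (step fillThenBalance D ids r C).pos < loadImbalance C.pos :=
        imbalance_lt_of_transfer hfx hyc hxy hL
      omega

theorem IsProper.step [Nonempty A] (hC : IsProper ids m C) (hids : Function.Injective ids)
    (hconn : (D.snapshot r).Connected) :
    IsProper ids (m - 1) (step fillThenBalance D ids r C) := by
  obtain ⟨h, hm⟩ | ⟨h, hocc, hm⟩ | ⟨h, hb⟩ := hC
  · exact h.isProper_step_false D r hids hconn hm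
  · exact h.isProper_step_true D r hids hconn hocc hm
  · refine Or.inr (Or.inr ⟨fun a => ?_, ?_⟩)
    · simp only [BalancedDispersion.step, decision, h, if_true]
    · have : (BalancedDispersion.step fillThenBalance D ids r C).pos = C.pos := by
        funext a
        simp only [BalancedDispersion.step, decision, h, if_true]
      rwa [this]

/-- The initial budget allows `k` rounds for filling holes on top of the reserve `2k + 2`. -/
theorem isProper_run [Nonempty A] (hids : Function.Injective ids)
    (hconn : ∀ r, (D.snapshot r).Connected) (start : A → V) :
    IsProper ids (3 * Fintype.card A + 2 - r) (run fillThenBalance D ids start r) := by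
  induction r with
  | zero => exact Or.inl ⟨⟨fun _ => rfl, fun _ => rfl⟩, by omega⟩
  | succ r ih => exact ih.step D r hids (hconn r)

end Main

end BalancedDispersion

/-! ### The main theorem -/

theorem mainTheorem7 :
    ∃ CT : ℕ, ∀ c : ℕ, ∃ CM : ℕ,
      ∀ (n k ℓ : ℕ) (D : BalancedDispersion.DynamicGraph (Fin n)) (ids : Fin k → ℕ)
        (start : Fin k → Fin n),
        1 ≤ k →
        D.IsBoundedOneIntervalConnected ℓ →
        Function.Injective ids →
        (∀ a, 1 ≤ ids a ∧ ids a ≤ n ^ c) →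
        let exec := BalancedDispersion.run BalancedDispersion.fillThenBalance D ids start
        -- within `CT * k` rounds all agents have terminated, in a balanced configuration
        (∃ T ≤ CT * k, ∀ r ≥ T,
          BalancedDispersion.IsBalanced (exec r).pos ∧ ∀ a, (exec r).halted a = true) ∧
        -- no agent terminates before balanced dispersion has been achieved
        (∀ r a, (exec r).halted a = true → BalancedDispersion.IsBalanced (exec r).pos) ∧
        -- every agent uses `O(log n)` bits of memory
        (∀ r a, ((exec r).mem a).length ≤ CM * (Nat.log 2 n + 1)) := by
  refine ⟨5, fun c => ⟨c + 2, ?_⟩⟩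
  intro n k ℓ D ids start hk hD hids hrange exec
  have : Nonempty (Fin k) := ⟨⟨0, hk⟩⟩
  have hproper : ∀ r, BalancedDispersion.IsProper ids (3 * k + 2 - r) (exec r) := fun r => by
    simpa using BalancedDispersion.isProper_run D r hids (fun r => (hD r).1) start
  -- As `k ≥ 1`, `3k + 2 ≤ 5k`. The budget is then `0`, which both active alternatives of `IsProper`
  -- exclude.
  refine ⟨⟨5 * k, le_rfl, fun r hr => ?_⟩, fun r a ha => ?_, fun r a => ?_⟩
  · obtain ⟨-, h⟩ | ⟨-, -, h⟩ | ⟨h, hb⟩ := hproper r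
    · omega
    · omega
    · exact ⟨hb, h⟩
  · obtain ⟨h, -⟩ | ⟨h, -⟩ | ⟨-, hb⟩ := hproper r
    · simp [h.halted a] at ha
    · simp [h.halted a] at ha
    · exact hb
  · obtain ⟨P, hP⟩ := BalancedDispersion.exists_mem_eq_memory (ids := ids) D start r a
    rw [show (exec r).mem a = _ from hP]
    exact BalancedDispersion.memory_length_le P (hrange a).2
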